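/- A coarsely oriented tree is a pair $(T,h)$ of a locally finite simplicial tree $T$ (non-empty, with its path metric $d_T$, every edge having length $1$) and a real-valued height function $h$ on its vertices; the height change from $v$ to $w$ is $h(w)-h(v)$. The tree is \emph{homogeneous} if the multiset $\{h(w)-h(v) : w \text{ adjacent to } v\}$ is the same for all vertices $v$. A map $f$ from the vertices of $T_1$ to the vertices of $T_2$ is a \emph{quasi-isometry} if there are $K\ge 1$, $C\ge 0$ with $K^{-1}d_{T_1}(x,y)-C\le d_{T_2}(f(x),f(y))\le K d_{T_1}(x,y)+C$ for all $x,y$, and every vertex of $T_2$ is within distance $C$ of the image of $f$. It is \emph{coarsely orientation preserving} if there is $C>0$ with $|(h_1(w)-h_1(v))-(h_2(f(w))-h_2(f(v)))|\le C$ for all vertices $v,w$ of $T_1$. The \emph{oriented tree of type $(2,2)$} is the $4$-valent tree with every edge oriented so that at every vertex two edges point away from it and two point towards it, with a height function that increases by $1$ along each oriented edge; explicitly, it is the Cayley graph of the free group on two generators, with the exponent sum as height. \textbf{Theorem (Classification of Homogeneous Trees).} Let $(T,h)$ be a homogeneous coarsely oriented tree. Then exactly one of the following three statements holds: \begin{enumerate}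 \item $h$ is constant; \item either at every vertex of $T$ one edge strictly increases height and all the other edges at the vertex strictly decrease height, or at every vertex of $T$ one edge strictly decreases height and all the other edges at the vertex strictly increase height; \item there is a coarsely orientation preserving quasi-isometry from $T$ to the oriented tree of type $(2,2)$. \end{enumerate} In particular, if at every vertex of $T$ at least two edges strictly increase height and at least two edges strictly decrease height, then there is a coarsely orientation preserving quasi-isometry from $T$ to the oriented tree of type $(2,2)$. -/

import Mathlib

/-!
A coarsely oriented tree is a locally finite simplicial tree, here a `SimpleGraph V` with
`IsTree`, together with a real height function `h : V → ℝ` on its vertices. The height change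
from `v` to `w` is `h w - h v`. The tree is metrized by its path metric `SimpleGraph.dist`.
-/

namespace CoarseTree

/-- The multiset of the height changes, starting at `v`, along the edges incident to `v`. -/
def edgeHeightChanges {V : Type*} (T : SimpleGraph V) [T.LocallyFinite] (h : V → ℝ) (v : V) :
    Multiset ℝ :=
  (T.neighborFinset v).val.map fun w => h w - h v

/-- The multiset of height changes of the edges incident to a vertex is the same at all vertices. -/
def IsHomogeneous {V : Type*} (T : SimpleGraph V) [T.LocallyFinite] (h : V → ℝ) : Prop :=
  ∀ v w : V, edgeHeightChanges T h v = edgeHeightChanges T h w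

/-- `f` is a quasi-isometry for the path metrics of the (connected) graphs `T₁` and `T₂`. -/
def IsQuasiIsometry {V₁ V₂ : Type*} (T₁ : SimpleGraph V₁) (T₂ : SimpleGraph V₂)
    (f : V₁ → V₂) : Prop :=
  ∃ K C : ℝ, 1 ≤ K ∧ 0 ≤ C ∧
    (∀ x y : V₁, K⁻¹ * (T₁.dist x y : ℝ) - C ≤ (T₂.dist (f x) (f y) : ℝ) ∧
      (T₂.dist (f x) (f y) : ℝ) ≤ K * (T₁.dist x y : ℝ) + C) ∧
    ∀ y : V₂, ∃ x : V₁, (T₂.dist (f x) y : ℝ) ≤ C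

/-- `f` preserves height changes up to a uniformly bounded additive error. -/
def CoarselyPreservesHeight {V₁ V₂ : Type*} (h₁ : V₁ → ℝ) (h₂ : V₂ → ℝ) (f : V₁ → V₂) : Prop :=
  ∃ C : ℝ, 0 < C ∧ ∀ v w : V₁, |(h₁ w - h₁ v) - (h₂ (f w) - h₂ (f v))| ≤ C

/-- There is a coarsely orientation preserving quasi-isometry from `(T₁, h₁)` to `(T₂, h₂)`. -/
def CoarselyOrientedQI {V₁ V₂ : Type*} (T₁ : SimpleGraph V₁) (h₁ : V₁ → ℝ)
    (T₂ : SimpleGraph V₂) (h₂ : V₂ → ℝ) : Prop :=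
  ∃ f : V₁ → V₂, IsQuasiIsometry T₁ T₂ f ∧ CoarselyPreservesHeight h₁ h₂ f

/-- At every vertex one edge strictly increases height and all the others strictly decrease it. -/
def OneUpOthersDown {V : Type*} (T : SimpleGraph V) (h : V → ℝ) : Prop :=
  ∀ v : V, ∃ w : V, T.Adj v w ∧ h v < h w ∧ ∀ u : V, T.Adj v u → u ≠ w → h u < h v

/-- At every vertex one edge strictly decreases height and all the others strictly increase it. -/
def OneDownOthersUp {V : Type*} (T : SimpleGraph V) (h : V → ℝ) : Prop :=
  ∀ v : V, ∃ w : V, T.Adj v w ∧ h w < h v ∧ ∀ u : V, T.Adj v u → u ≠ w → h v < h u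

/-- The height function is that of an orientation of the tree `T` (each edge changes height by
`1` or `-1`) for which `n` edges point away from, and `m` edges point towards, each vertex. -/
structure IsOrientedTreeOfType {V : Type*} (T : SimpleGraph V) (h : V → ℝ) (n m : ℕ) : Prop where
  isTree : T.IsTree
  height_change : ∀ v w : V, T.Adj v w → h w - h v = 1 ∨ h w - h v = -1
  card_away : ∀ v : V, {w : V | T.Adj v w ∧ h w - h v = 1}.encard = n
  card_towards : ∀ v : V, {w : V | T.Adj v w ∧ h w - h v = -1}.encard = m

/-- The oriented tree of type `(2, 2)`, as the Cayley graph of the free group on two generators: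
the edges lead from `g` to `g * x` for the generators `x`. -/
def tree22 : SimpleGraph (FreeGroup (Fin 2)) :=
  SimpleGraph.mulCayley (Set.range (FreeGroup.of : Fin 2 → FreeGroup (Fin 2)))

/-- The height function on `tree22` for the orientation of its edges from `g` to `g * x`: the
exponent sum. -/
noncomputable def height22 (g : FreeGroup (Fin 2)) : ℝ :=
  Multiplicative.toAdd (FreeGroup.lift (fun _ : Fin 2 => Multiplicative.ofAdd (1 : ℝ)) g)

theorem height22_mul_of (g : FreeGroup (Fin 2)) (i : Fin 2) :
    height22 (g * FreeGroup.of i) = height22 g + 1 := by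
  simp [height22]

theorem tree22_adj (u v : FreeGroup (Fin 2)) :
    tree22.Adj u v ↔ ∃ i, u * FreeGroup.of i = v ∨ u = v * FreeGroup.of i := by
  rw [tree22, SimpleGraph.mulCayley_adj']
  constructor
  · rintro ⟨-, g, ⟨i, rfl⟩, h⟩
    exact ⟨i, h⟩
  · rintro ⟨i, h⟩
    refine ⟨?_, _, ⟨i, rfl⟩, h⟩
    rintro rfl
    rcases h with h | h
    · simpa [h] using height22_mul_of u i
    · simpa [← h] using height22_mul_of u i

theorem tree22_connected : tree22.Connected := by
  have key : ∀ g u : FreeGroup (Fin 2), tree22.Reachable u (u * g) := by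
    intro g
    induction g using FreeGroup.induction_on with
    | C1 => intro u; simp
    | of i => intro u; exact ((tree22_adj _ _).2 ⟨i, Or.inl rfl⟩).reachable
    | inv_of i _ =>
      intro u
      exact ((tree22_adj _ _).2 ⟨i, Or.inr (by simp)⟩).reachable
    | mul x y hx hy =>
      intro u
      rw [← mul_assoc]
      exact (hx u).trans (hy _)
  exact ⟨fun u v => by simpa using key (u⁻¹ * v) u⟩

/-- Away from the identity, multiplication by a letter on the left keeps the last letter of the
reduced word. -/
theorem getLast_toWord_letter_mul (p : Fin 2 × Bool) (x : FreeGroup (Fin 2)) (hx : x ≠ 1)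
    (hpx : FreeGroup.mk [p] * x ≠ 1) :
    (FreeGroup.mk [p] * x).toWord.getLast? = x.toWord.getLast? := by
  have e : (FreeGroup.mk [p] * x).toWord = FreeGroup.reduce (p :: x.toWord) := by
    conv_lhs => rw [← FreeGroup.mk_toWord (x := x), FreeGroup.mul_mk, FreeGroup.toWord_mk]
    rfl
  have h0 : x.toWord ≠ [] := by simpa using hx
  have h1 : (FreeGroup.mk [p] * x).toWord ≠ [] := by simpa using hpx
  rw [e] at h1 ⊢
  rw [FreeGroup.reduce.cons, FreeGroup.reduce_toWord] at h1 ⊢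
  cases hw : x.toWord with
  | nil => exact absurd hw h0
  | cons a t =>
    rw [hw] at h1
    dsimp only at h1 ⊢
    split_ifs at h1 ⊢ with hc
    · cases t with
      | nil => exact absurd rfl h1
      | cons b s => simp
    · simp

theorem tree22_isAcyclic : tree22.IsAcyclic := by
  have main : ∀ (g : FreeGroup (Fin 2)) (i : Fin 2),
      tree22.IsBridge s(g, g * FreeGroup.of i) := by
    intro g i
    let P : FreeGroup (Fin 2) → Prop := fun k => (k⁻¹ * g).toWord.getLast? = some (i, false)
    have inv_of : ∀ j : Fin 2, (FreeGroup.of j)⁻¹ = FreeGroup.mk [(j, false)] := fun j => rfl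
    have step : ∀ (k : FreeGroup (Fin 2)) (j : Fin 2),
        s(k, k * FreeGroup.of j) ≠ s(g, g * FreeGroup.of i) → (P k ↔ P (k * FreeGroup.of j)) := by
      intro k j hne
      have e : (k * FreeGroup.of j)⁻¹ * g = FreeGroup.mk [(j, false)] * (k⁻¹ * g) := by
        rw [← inv_of]; group
      by_cases h1 : k⁻¹ * g = 1
      · obtain rfl : k = g := inv_mul_eq_one.1 h1
        have hij : j ≠ i := by rintro rfl; exact hne rfl
        simp only [P, e, h1, mul_one, FreeGroup.toWord_one, FreeGroup.toWord_mk]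
        simpa using hij
      by_cases h2 : FreeGroup.mk [(j, false)] * (k⁻¹ * g) = 1
      · have h3 : k⁻¹ * g = FreeGroup.of j := by
          rw [← inv_of, inv_mul_eq_one] at h2
          exact h2.symm
        simp only [P]
        rw [e, h2, h3]
        simp
      · simp only [P, e]
        rw [getLast_toWord_letter_mul _ _ h1 h2]
    have walk : ∀ u v : FreeGroup (Fin 2),
        (tree22.deleteEdges {s(g, g * FreeGroup.of i)}).Walk u v → (P u ↔ P v) := by
      intro u v w
      induction w with
      | nil => rfl
      | cons hadj _ ih =>
        rename_i a b _ _
        refine Iff.trans ?_ ih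
        rw [SimpleGraph.deleteEdges_adj, tree22_adj] at hadj
        obtain ⟨⟨j, rfl | rfl⟩, hn⟩ := hadj
        · exact step _ j (by simpa using hn)
        · refine (step _ j ?_).symm
          rw [Sym2.eq_swap]
          simpa using hn
    rw [SimpleGraph.isBridge_iff]
    rintro ⟨w⟩
    have := (walk _ _ w).2
    have hP : P (g * FreeGroup.of i) := by
      have : (g * FreeGroup.of i)⁻¹ * g = FreeGroup.mk [(i, false)] := by
        rw [← inv_of]; group
      simp only [P]
      rw [this, FreeGroup.toWord_mk]
      simp
    have := this hP
    simp [P] at this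
  rw [SimpleGraph.isAcyclic_iff_forall_adj_isBridge]
  intro v w hvw
  rw [tree22_adj] at hvw
  obtain ⟨i, rfl | rfl⟩ := hvw
  · exact main _ i
  · rw [Sym2.eq_swap]
    exact main _ i

/-- `tree22` with `height22` is an oriented tree of type `(2, 2)`. -/
theorem tree22_isOrientedTreeOfType : IsOrientedTreeOfType tree22 height22 2 2 where
  isTree := ⟨tree22_connected, tree22_isAcyclic⟩
  height_change v w hvw := by
    rw [tree22_adj] at hvw
    obtain ⟨i, rfl | rfl⟩ := hvw <;> rw [height22_mul_of] <;> norm_num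
  card_away v := by
    have : {w | tree22.Adj v w ∧ height22 w - height22 v = 1} =
        (fun i : Fin 2 => v * FreeGroup.of i) '' Set.univ := by
      ext w
      simp only [Set.mem_ofPred_eq, tree22_adj, Set.image_univ, Set.mem_range]
      constructor
      · rintro ⟨⟨i, rfl | rfl⟩, h⟩
        · exact ⟨i, rfl⟩
        · rw [height22_mul_of] at h; linarith
      · rintro ⟨i, rfl⟩
        exact ⟨⟨i, Or.inl rfl⟩, by rw [height22_mul_of]; ring⟩
    rw [this, Function.Injective.encard_image]
    · simp [Set.encard_univ]
    · intro i j hij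
      exact FreeGroup.of_injective (mul_left_cancel hij)
  card_towards v := by
    have : {w | tree22.Adj v w ∧ height22 w - height22 v = -1} =
        (fun i : Fin 2 => v * (FreeGroup.of i)⁻¹) '' Set.univ := by
      ext w
      simp only [Set.mem_ofPred_eq, tree22_adj, Set.image_univ, Set.mem_range]
      constructor
      · rintro ⟨⟨i, rfl | rfl⟩, h⟩
        · rw [height22_mul_of] at h; linarith
        · exact ⟨i, by simp⟩
      · rintro ⟨i, rfl⟩
        refine ⟨⟨i, Or.inr (by simp)⟩, ?_⟩
        have := height22_mul_of (v * (FreeGroup.of i)⁻¹) i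
        rw [inv_mul_cancel_right] at this
        linarith
    rw [this, Function.Injective.encard_image]
    · simp [Set.encard_univ]
    · intro i j hij
      exact FreeGroup.of_injective (inv_injective (mul_left_cancel hij))

end CoarseTree

/-! Suppose that neither of the first two alternatives holds. By homogeneity every vertex has an
edge that drops by a fixed amount, and a second edge that does not rise; the same holds with signs
reversed. So from any vertex one can move away from a base edge and descend, or ascend, at a
definite rate, whichever edge leads back. This is `IsFlexibleTree`, and `tree22` is of this kind.

Any two flexible trees are equivalent (`IsFlexibleTree.coarselyOrientedQI`). Both are cut
simultaneously into finite paths, the clusters. If the current vertex of the first tree is the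
higher one, its path descends while that of the second tree ascends; otherwise the reverse. A path
of `k` vertices in a tree of valence `r + 2` has `k * r + 1` exits away from the base edge, so `k *
r = l * s` makes the exits of the two paths equinumerous. Matching early exits with late ones
(`exists_matching`) ensures that no matched pair of exits increases the excess in height of the
higher side (`exists_cluster_pair`). As a single step changes heights by a bounded amount, the
discrepancy stays bounded forever. The clusters of both trees are then indexed by the same words,
and relating the vertices of equally addressed clusters gives the quasi-isometry.

For exclusivity, in a tree with one upward edge per vertex, two vertices joined by a walk below
height `H` have a common ancestor below `H`, which bounds their distance. A coarse equivalence would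
carry this bound to `tree22`, which contains arbitrarily wide valleys. Constant height is excluded
because `height22` is unbounded. -/

namespace CoarseTree

/-! ### Parent maps directed towards an edge -/

/-- `par` sends every vertex of `T` to its neighbour in the direction of the edge joining `a` and
`b`, and exchanges `a` and `b`. -/
structure IsParentMap {V : Type*} (T : SimpleGraph V) (a b : V) (par : V → V) : Prop where
  ne : a ≠ b
  par_left : par a = b
  par_right : par b = a
  adj : ∀ x, T.Adj x (par x)
  par_eq_or : ∀ x y, T.Adj x y → par x = y ∨ par y = x
  exists_depth : ∃ dep : V → ℕ, ∀ x, par (par x) ≠ x → dep (par x) < dep x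

/-- Parents are next vertices on geodesics to `a`, except that `a` gets the parent `b`; depth is the
distance to `a`. Basing the map at an edge instead of a root gives every vertex a parent, so all
vertices of a regular tree have equally many children and no root needs special treatment. -/
theorem exists_isParentMap {V : Type*} {T : SimpleGraph V} (hT : T.IsTree) {a b : V}
    (hab : T.Adj a b) : ∃ par : V → V, IsParentMap T a b par := by
  classical
  have hgeo : ∀ x, ∃ p : T.Walk x a, p.IsPath ∧ p.length = T.dist x a :=
    fun x => hT.connected.exists_path_of_dist x a
  choose p hp hlen using hgeo
  have hsnd : ∀ x y, T.Adj x y → T.dist a x = T.dist a y + 1 → (p x).snd = y := by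
    intro x y hxy hd
    have hq : (SimpleGraph.Walk.cons hxy (p y)).IsPath := by
      apply SimpleGraph.Walk.isPath_of_length_eq_dist
      rw [SimpleGraph.Walk.length_cons, hlen, SimpleGraph.dist_comm, ← hd, SimpleGraph.dist_comm]
    have := congrArg Subtype.val
      ((hT.isAcyclic.subsingleton_path x a).elim ⟨p x, hp x⟩ ⟨_, hq⟩)
    simp only at this
    rw [this, SimpleGraph.Walk.snd_cons]
  have hadj : ∀ x, x ≠ a → T.Adj x (p x).snd := fun x hx =>
    SimpleGraph.Walk.adj_snd (SimpleGraph.Walk.not_nil_of_ne hx)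
  have hdist : ∀ x, x ≠ a → T.dist a x = T.dist a (p x).snd + 1 := by
    intro x hx
    rcases hT.dist_eq_dist_add_one_of_adj a (hadj x hx) with h | h
    · exact h
    · have hnil : ¬ (p x).Nil := SimpleGraph.Walk.not_nil_of_ne hx
      have h1 := SimpleGraph.dist_le (p x).tail
      have h2 := SimpleGraph.Walk.length_tail_add_one hnil
      rw [hlen] at h2
      rw [SimpleGraph.dist_comm (u := a), SimpleGraph.dist_comm (u := a)] at h
      omega
  obtain ⟨par, hpa, hpn⟩ : ∃ par : V → V, par a = b ∧ ∀ x, x ≠ a → par x = (p x).snd :=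
    ⟨fun x => if x = a then b else (p x).snd, if_pos rfl, fun x hx => if_neg hx⟩
  have hpb : par b = a := by
    rw [hpn b hab.ne']
    exact hsnd _ _ hab.symm (by simpa using SimpleGraph.dist_eq_one_iff_adj.2 hab)
  refine ⟨par, hab.ne, hpa, hpb, ?_, ?_, T.dist a, ?_⟩
  · intro x
    by_cases hx : x = a
    · rwa [hx, hpa]
    · rw [hpn x hx]
      exact hadj x hx
  · intro x y hxy
    rcases hT.dist_eq_dist_add_one_of_adj a hxy with h | h
    · left
      have hx : x ≠ a := by rintro rfl; simp at h
      rw [hpn x hx]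
      exact hsnd x y hxy h
    · right
      have hy : y ≠ a := by rintro rfl; simp at h
      rw [hpn y hy]
      exact hsnd y x hxy.symm h
  · intro x hx
    have hxa : x ≠ a := by
      rintro rfl
      exact hx (by rw [hpa, hpb])
    rw [hpn x hxa]
    have := hdist x hxa
    omega

theorem IsParentMap.par_eq_of_ne {V : Type*} {T : SimpleGraph V} {a b : V} {par : V → V}
    (hpar : IsParentMap T a b par) {x y : V} (hxy : T.Adj x y) (hne : y ≠ par x) : par y = x :=
  (hpar.par_eq_or x y hxy).resolve_left fun h => hne h.symm

/-! ### Clusters and their addresses -/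

/-- `S` is a connected set of descendants of `x`, and `y` enumerates the vertices outside `S`
whose parent lies in `S`. -/
structure IsCluster {V κ : Type*} (T : SimpleGraph V) (par : V → V) (S : Set V) (x : V)
    (y : κ → V) : Prop where
  mem : x ∈ S
  par_mem : ∀ z ∈ S, z ≠ x → par z ∈ S ∧ par (par z) ≠ z
  exit : ∀ z ∈ S, ∀ w, T.Adj z w → w ≠ par z → w ∈ S ∨ ∃ m, w = y m
  port_par : ∀ m, par (y m) ∈ S ∧ par (par (y m)) ≠ y m
  port_notMem : ∀ m, y m ∉ S
  injective : Function.Injective y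

/-- Finite words over `κ`, starting from one of two roots. -/
inductive Address (κ : Type*)
  | root (s : Bool) : Address κ
  | child (i : Address κ) (m : κ) : Address κ

/-- Two addresses are equal, or one extends the other by a letter, or both are roots. -/
def Address.Near {κ : Type*} (i j : Address κ) : Prop :=
  i = j ∨ (∃ m, j = i.child m) ∨ (∃ m, i = j.child m) ∨ ∃ s t, i = root s ∧ j = root t

/-- A system of clusters in a tree, indexed by addresses: the clusters of the children of `i` start
at the vertices that leave the cluster of `i`. -/
structure IsClusterSystem {V κ : Type*} (T : SimpleGraph V) (a b : V) (par : V → V)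
    (σ : Address κ → V) (S : Address κ → Set V) : Prop where
  isParentMap : IsParentMap T a b par
  root_true : σ (.root true) = a
  root_false : σ (.root false) = b
  isCluster : ∀ i, IsCluster T par (S i) (σ i) fun m => σ (i.child m)

namespace IsClusterSystem

variable {V κ : Type*} {T : SimpleGraph V} {a b : V} {par : V → V} {σ : Address κ → V}
  {S : Address κ → Set V}

theorem par_par_root (hS : IsClusterSystem T a b par σ S) (s : Bool) :
    par (par (σ (.root s))) = σ (.root s) := by
  have h := hS.isParentMap
  cases s
  · rw [hS.root_false, h.par_right, h.par_left]
  · rw [hS.root_true, h.par_left, h.par_right]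

/-- The three ways in which a vertex can lie in a cluster, by where its parent lies; outside the
base edge the parent is strictly less deep, which allows induction. -/
theorem cases_mem (hS : IsClusterSystem T a b par σ S) {i : Address κ} {z : V} (hz : z ∈ S i) :
    (∃ s, i = .root s ∧ z = σ i) ∨ (par (par z) ≠ z ∧ z ≠ σ i ∧ par z ∈ S i) ∨
      (par (par z) ≠ z ∧ z = σ i ∧ ∃ j m, i = .child j m ∧ par z ∈ S j) := by
  by_cases h : z = σ i
  · cases i with
    | root s => exact Or.inl ⟨s, rfl, h⟩
    | child j m =>
      have := (hS.isCluster j).port_par m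
      rw [← h] at this
      exact Or.inr (Or.inr ⟨this.2, h, j, m, rfl, this.1⟩)
  · have := (hS.isCluster i).par_mem z hz h
    exact Or.inr (Or.inl ⟨this.2, h, this.1⟩)

/-- Induction on depth: the parent lies in only one cluster, and whether the vertex stays in that
cluster or leaves it through a given exit is determined, since exits are injective and lie outside.
-/
theorem address_unique (hS : IsClusterSystem T a b par σ S) {z : V} {i j : Address κ}
    (hi : z ∈ S i) (hj : z ∈ S j) : i = j := by
  obtain ⟨dep, hdep⟩ := hS.isParentMap.exists_depth
  induction hn : dep z using Nat.strong_induction_on generalizing z i j with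
  | _ n ih =>
    subst hn
    rcases hS.cases_mem hi with ⟨s, rfl, h1⟩ | ⟨h1, h2, h3⟩ | ⟨h1, h2, i', m, rfl, h3⟩ <;>
    rcases hS.cases_mem hj with ⟨t, rfl, k1⟩ | ⟨k1, k2, k3⟩ | ⟨k1, k2, j', l, rfl, k3⟩
    · have hne := hS.isParentMap.ne
      have := h1.symm.trans k1
      cases s <;> cases t <;> simp only [hS.root_true, hS.root_false] at this
      · rfl
      · exact absurd this.symm hne
      · exact absurd this hne
      · rfl
    · exact absurd (h1 ▸ hS.par_par_root s) k1
    · exact absurd (h1 ▸ hS.par_par_root s) k1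
    · exact absurd (k1 ▸ hS.par_par_root t) h1
    · exact ih _ (hdep z h1) h3 k3 rfl
    · obtain rfl := ih _ (hdep z h1) h3 k3 rfl
      exact absurd (k2 ▸ hi) ((hS.isCluster i).port_notMem l)
    · exact absurd (k1 ▸ hS.par_par_root t) h1
    · obtain rfl := ih _ (hdep z h1) h3 k3 rfl
      exact absurd (h2 ▸ hj) ((hS.isCluster i').port_notMem m)
    · obtain rfl := ih _ (hdep z h1) h3 k3 rfl
      rw [(hS.isCluster i').injective (h2.symm.trans k2)]

theorem exists_near_of_adj (hS : IsClusterSystem T a b par σ S) {z w : V} {i : Address κ}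
    (hz : z ∈ S i) (hzw : T.Adj z w) : ∃ j, w ∈ S j ∧ i.Near j := by
  by_cases hw : w = par z
  · subst hw
    rcases hS.cases_mem hz with ⟨s, rfl, h1⟩ | ⟨h1, h2, h3⟩ | ⟨h1, h2, j, m, rfl, h3⟩
    · refine ⟨.root !s, ?_, Or.inr (Or.inr (Or.inr ⟨s, !s, rfl, rfl⟩))⟩
      have : par z = σ (.root !s) := by
        rw [h1]
        cases s
        · simp [hS.root_true, hS.root_false, hS.isParentMap.par_right]
        · simp [hS.root_true, hS.root_false, hS.isParentMap.par_left]
      rw [this]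
      exact (hS.isCluster _).mem
    · exact ⟨i, h3, Or.inl rfl⟩
    · exact ⟨j, h3, Or.inr (Or.inr (Or.inl ⟨m, rfl⟩))⟩
  · rcases (hS.isCluster i).exit z hz w hzw hw with h | ⟨m, rfl⟩
    · exact ⟨i, h, Or.inl rfl⟩
    · exact ⟨i.child m, (hS.isCluster _).mem, Or.inr (Or.inl ⟨m, rfl⟩)⟩

theorem near_of_adj (hS : IsClusterSystem T a b par σ S) {z w : V} {i j : Address κ}
    (hz : z ∈ S i) (hw : w ∈ S j) (hzw : T.Adj z w) : i.Near j := by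
  obtain ⟨k, hk, hik⟩ := hS.exists_near_of_adj hz hzw
  rwa [hS.address_unique hw hk]

theorem exists_mem (hS : IsClusterSystem T a b par σ S) (hT : T.Connected) (z : V) :
    ∃ i, z ∈ S i := by
  have h := hT a z
  rw [SimpleGraph.reachable_iff_reflTransGen] at h
  induction h with
  | refl => exact ⟨.root true, hS.root_true ▸ (hS.isCluster _).mem⟩
  | tail _ hadj ih =>
    obtain ⟨i, hi⟩ := ih
    obtain ⟨j, hj, -⟩ := hS.exists_near_of_adj hi hadj
    exact ⟨j, hj⟩

theorem dist_le_of_near (hS : IsClusterSystem T a b par σ S) (hT : T.Connected) {D : ℕ}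
    (hD : ∀ i, ∀ z ∈ S i, T.dist (σ i) z ≤ D) {i j : Address κ} (hij : i.Near j) {z w : V}
    (hz : z ∈ S i) (hw : w ∈ S j) : T.dist z w ≤ 3 * D + 1 := by
  have tri : ∀ x y u : V, T.dist x u ≤ T.dist x y + T.dist y u := fun x y u => hT.dist_triangle
  -- The parent of a child's start lies in the cluster of `i`, within `D` of its start. Adding at
  -- most `D` at either end then gives `3 * D + 1`.
  have hstart : T.dist (σ i) (σ j) ≤ D + 1 := by
    have hchild : ∀ (i : Address κ) (m : κ), T.dist (σ i) (σ (i.child m)) ≤ D + 1 := by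
      intro i m
      have h1 := hD i _ ((hS.isCluster i).port_par m).1
      have h2 := SimpleGraph.dist_eq_one_iff_adj.2 (hS.isParentMap.adj (σ (i.child m)))
      have h3 := tri (σ i) (par (σ (i.child m))) (σ (i.child m))
      rw [SimpleGraph.dist_comm (u := par _)] at h3
      omega
    rcases hij with rfl | ⟨m, rfl⟩ | ⟨m, rfl⟩ | ⟨s, t, rfl, rfl⟩
    · simp
    · exact hchild _ _
    · rw [SimpleGraph.dist_comm]
      exact hchild _ _
    · have h : T.dist a b = 1 := by
        rw [SimpleGraph.dist_eq_one_iff_adj, ← hS.isParentMap.par_left]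
        exact hS.isParentMap.adj a
      have h' : T.dist b a = 1 := by rwa [SimpleGraph.dist_comm]
      cases s <;> cases t <;> simp [hS.root_true, hS.root_false, h, h']
  have h1 := hD i z hz
  have h2 := hD j w hw
  have h3 := tri z (σ i) w
  have h4 := tri (σ i) (σ j) w
  rw [SimpleGraph.dist_comm (u := z) (v := σ i)] at h3
  omega

end IsClusterSystem

/-! ### Descending paths as clusters -/

/-- At every vertex at least two edges do not increase height, and at least one edge decreases
height by at least `c`. -/
def HasDescents {V : Type*} (T : SimpleGraph V) (h : V → ℝ) (c : ℝ) : Prop :=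
  ∀ x, (∃ y z, y ≠ z ∧ T.Adj x y ∧ T.Adj x z ∧ h y ≤ h x ∧ h z ≤ h x) ∧
    ∃ y, T.Adj x y ∧ h y ≤ h x - c

/-- An injective enumeration of the neighbours of a vertex other than two given ones. -/
theorem exists_enum_neighborSet_diff {V : Type*} {T : SimpleGraph V} {r : ℕ} {x u v : V}
    (hdeg : (T.neighborSet x).ncard = r + 2) (hu : T.Adj x u) (hv : T.Adj x v) (huv : u ≠ v) :
    ∃ s : Fin r → V, Function.Injective s ∧
      ∀ w, (∃ i, s i = w) ↔ T.Adj x w ∧ w ≠ u ∧ w ≠ v := by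
  have hfin : (T.neighborSet x).Finite := Set.finite_of_ncard_ne_zero (by omega)
  have hcard : (T.neighborSet x \ {u, v}).ncard = r := by
    have hsub : ({u, v} : Set V) ⊆ T.neighborSet x := by
      rintro w (rfl | rfl) <;> assumption
    rw [Set.ncard_sdiff hsub, hdeg, Set.ncard_pair huv]
    omega
  have : Finite ↥(T.neighborSet x \ {u, v}) := hfin.sdiff.to_subtype
  let e := Finite.equivFinOfCardEq (α := ↥(T.neighborSet x \ {u, v})) (n := r) hcard
  refine ⟨fun i => (e.symm i).1, fun i j hij => e.symm.injective (Subtype.ext hij), fun w => ?_⟩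
  constructor
  · rintro ⟨i, rfl⟩
    obtain ⟨h1, h2⟩ := (e.symm i).2
    exact ⟨h1, fun h => h2 (Or.inl h), fun h => h2 (Or.inr h)⟩
  · intro hw
    exact ⟨e ⟨w, by simpa [not_or] using hw⟩, by simp⟩

theorem abs_sub_le_mul_dist {V : Type*} {T : SimpleGraph V} (hT : T.Connected) {h : V → ℝ} {B : ℝ}
    (hB : ∀ x y, T.Adj x y → |h y - h x| ≤ B) (x y : V) : |h y - h x| ≤ B * T.dist x y := by
  obtain ⟨p, hp⟩ := hT.exists_walk_length_eq_dist x y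
  rw [← hp]
  clear hp
  induction p with
  | nil => simp
  | @cons u v w huv p ih =>
    rw [SimpleGraph.Walk.length_cons]
    push_cast
    have := abs_sub_le (h w) (h v) (h u)
    have := hB u v huv
    linarith

/-- A descending path of length `k` starting at `x` is a cluster. Its exits lie low except near the
beginning of the path. -/
theorem exists_descending_cluster {V : Type*} {T : SimpleGraph V} (hT : T.Connected) {a b : V}
    {par : V → V} (hpar : IsParentMap T a b par) {r : ℕ}
    (hdeg : ∀ x, (T.neighborSet x).ncard = r + 2) {h : V → ℝ} {B c : ℝ}
    (hB : ∀ x y, T.Adj x y → |h y - h x| ≤ B) (hc : 0 ≤ c) (hdesc : HasDescents T h c)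
    {k : ℕ} (hk : 0 < k) (x : V) :
    ∃ (S : Set V) (y : Option (Fin k × Fin r) → V), IsCluster T par S x y ∧
      (∀ z ∈ S, T.dist x z ≤ k) ∧ (∀ m, T.dist x (y m) ≤ k + 1) ∧
      (∀ j i, h (y (some (j, i))) ≤ h x + B + c - c * j) ∧ h (y none) ≤ h x + c - c * k := by
  -- If the edge dropping by `c` leads to the parent, one of the two non-increasing edges avoids the
  -- parent. When the parent is not lower than `x`, this detour costs nothing: the drop leads to the
  -- parent only if `c ≤ 0`.
  have hchild : ∀ x, ∃ y, T.Adj x y ∧ y ≠ par x ∧ h y ≤ h x ∧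
      (h x ≤ h (par x) → h y ≤ h x - c) := by
    intro x
    obtain ⟨⟨y, z, hyz, hxy, hxz, hy, hz⟩, w, hxw, hw⟩ := hdesc x
    by_cases hwp : w = par x
    · have hex : ∃ v, T.Adj x v ∧ v ≠ par x ∧ h v ≤ h x := by
        by_cases hyp : y = par x
        · exact ⟨z, hxz, fun h => hyz (hyp.trans h.symm), hz⟩
        · exact ⟨y, hxy, hyp, hy⟩
      obtain ⟨v, hxv, hvp, hv⟩ := hex
      refine ⟨v, hxv, hvp, hv, fun hx => ?_⟩
      rw [← hwp] at hx
      linarith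
    · exact ⟨w, hxw, hwp, by linarith, fun _ => hw⟩
  choose χ hχadj hχpar hχle hχc using hchild
  have hside : ∀ x, ∃ s : Fin r → V, Function.Injective s ∧
      ∀ w, (∃ i, s i = w) ↔ T.Adj x w ∧ w ≠ par x ∧ w ≠ χ x := fun x =>
    exists_enum_neighborSet_diff (hdeg x) (hpar.adj x) (hχadj x) (hχpar x).symm
  choose side hinj hside using hside
  have hsadj : ∀ x i, T.Adj x (side x i) := fun x i => ((hside x _).1 ⟨i, rfl⟩).1
  have hspar : ∀ x i, side x i ≠ par x := fun x i => ((hside x _).1 ⟨i, rfl⟩).2.1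
  have hsχ : ∀ x i, side x i ≠ χ x := fun x i => ((hside x _).1 ⟨i, rfl⟩).2.2
  have hpχ : ∀ x, par (χ x) = x := fun x => hpar.par_eq_of_ne (hχadj x) (hχpar x)
  have hps : ∀ x i, par (side x i) = x := fun x i => hpar.par_eq_of_ne (hsadj x i) (hspar x i)
  obtain ⟨dep, hdep⟩ := hpar.exists_depth
  have hdepχ : ∀ x, dep x < dep (χ x) := fun x => by
    have := hdep (χ x) (by rw [hpχ]; exact (hχpar x).symm)
    rwa [hpχ] at this
  have hdeps : ∀ x i, dep x < dep (side x i) := fun x i => by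
    have := hdep (side x i) (by rw [hps]; exact (hspar x i).symm)
    rwa [hps] at this
  let z : ℕ → V := fun j => χ^[j] x
  have hz0 : z 0 = x := rfl
  have hzs : ∀ j, z (j + 1) = χ (z j) := fun j => Function.iterate_succ_apply' χ j x
  have hmono : StrictMono fun j => dep (z j) := strictMono_nat_of_lt_succ fun j => by
    simp only [hzs]
    exact hdepχ _
  have hzinj : Function.Injective z := fun i j hij => hmono.injective (congrArg dep hij)
  -- Only the first step can fail to drop by `c`: afterwards the path has arrived from a parent that
  -- is not lower.
  have hzh : ∀ j, h (z (j + 1)) ≤ h x - c * j := by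
    intro j
    induction j with
    | zero => simpa [hzs, hz0] using hχle x
    | succ j ih =>
      have := hχc (z (j + 1)) (by rw [hzs j, hpχ]; exact hχle _)
      rw [hzs (j + 1)]
      push_cast
      linarith
  have hzh' : ∀ j : ℕ, h (z j) ≤ h x + c - c * j := by
    intro j
    cases j with
    | zero => simp [hz0, hc]
    | succ j =>
      have := hzh j
      push_cast
      linarith
  have hzd : ∀ j, T.dist x (z j) ≤ j := by
    intro j
    induction j with
    | zero => simp [hz0]
    | succ j ih =>
      have h1 := SimpleGraph.dist_eq_one_iff_adj.2 (hχadj (z j))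
      have h2 := hT.dist_triangle (u := x) (v := z j) (w := z (j + 1))
      rw [hzs j] at h2 ⊢
      omega
  let y : Option (Fin k × Fin r) → V := fun m => m.elim (z k) fun p => side (z p.1) p.2
  have hyn : y none = z k := rfl
  have hys : ∀ j i, y (some (j, i)) = side (z j) i := fun j i => rfl
  obtain ⟨l, rfl⟩ : ∃ l, k = l + 1 := ⟨k - 1, by omega⟩
  refine ⟨{w | ∃ j < l + 1, z j = w}, y, ⟨⟨0, hk, hz0⟩, ?_, ?_, ?_, ?_, ?_⟩, ?_, ?_, ?_, ?_⟩
  · rintro w ⟨j, hj, rfl⟩ hne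
    cases j with
    | zero => exact absurd hz0 hne
    | succ j =>
      rw [hzs, hpχ]
      exact ⟨⟨j, by omega, rfl⟩, (hχpar _).symm⟩
  · rintro w ⟨j, hj, rfl⟩ v hv hvp
    by_cases hvχ : v = χ (z j)
    · rcases Nat.lt_succ_iff_lt_or_eq.1 hj with hj' | rfl
      · exact Or.inl ⟨j + 1, by omega, by rw [hzs, hvχ]⟩
      · exact Or.inr ⟨none, by rw [hyn, hzs, hvχ]⟩
    · obtain ⟨i, hi⟩ := (hside (z j) v).2 ⟨hv, hvp, hvχ⟩
      exact Or.inr ⟨some (⟨j, hj⟩, i), hi.symm⟩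
  · rintro (_ | ⟨j, i⟩)
    · rw [hyn, hzs, hpχ]
      exact ⟨⟨l, by omega, rfl⟩, (hχpar _).symm⟩
    · rw [hys, hps]
      exact ⟨⟨j, j.2, rfl⟩, (hspar _ _).symm⟩
  · rintro (_ | ⟨j, i⟩) ⟨n, hn, hne⟩
    · exact hn.ne (hzinj hne)
    · rw [hys] at hne
      -- The start `z 0` is less deep than any side vertex. A later path vertex equal to a side
      -- vertex would have the same parent, hence be the chosen child there, which side vertices are
      -- not.
      cases n with
      | zero =>
        have h1 := hdeps (z j) i
        rw [← hne] at h1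
        exact absurd (hmono.monotone (Nat.zero_le j)) (not_le.2 h1)
      | succ n =>
        have h1 := hps (z j) i
        rw [← hne, hzs, hpχ] at h1
        have := hsχ (z j) i
        rw [← hne, hzs, h1] at this
        exact this rfl
  · have hne : ∀ (j : Fin (l + 1)) i, z (l + 1) ≠ side (z j) i := by
      intro j i hne
      have h1 := hps (z j) i
      rw [← hne, hzs, hpχ] at h1
      have := hsχ (z j) i
      rw [← hne, hzs, h1] at this
      exact this rfl
    rintro (_ | ⟨j, i⟩) (_ | ⟨j', i'⟩) heq
    · rfl
    · exact absurd heq (hne j' i')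
    · exact absurd heq.symm (hne j i)
    · rw [hys, hys] at heq
      have h1 := congrArg par heq
      rw [hps, hps] at h1
      obtain rfl := Fin.ext (hzinj h1)
      rw [hinj _ heq]
  · rintro w ⟨j, hj, rfl⟩
    exact (hzd j).trans hj.le
  · rintro (_ | ⟨j, i⟩)
    · exact (hzd _).trans (Nat.le_succ _)
    · have h1 := SimpleGraph.dist_eq_one_iff_adj.2 (hsadj (z j) i)
      have h2 := hT.dist_triangle (u := x) (v := z j) (w := side (z j) i)
      have h3 := hzd j
      rw [hys]
      omega
  · intro j i
    have h1 := (abs_le.1 (hB _ _ (hsadj (z j) i))).2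
    have h2 := hzh' j
    rw [hys]
    linarith
  · exact hzh' _

theorem IsCluster.reindex {V κ κ' : Type*} {T : SimpleGraph V} {par : V → V} {S : Set V} {x : V}
    {y : κ → V} (hS : IsCluster T par S x y) (e : κ' ≃ κ) :
    IsCluster T par S x (y ∘ e) where
  mem := hS.mem
  par_mem := hS.par_mem
  exit z hz w hw hne := by
    rcases hS.exit z hz w hw hne with h | ⟨m, rfl⟩
    · exact Or.inl h
    · exact Or.inr ⟨e.symm m, by simp⟩
  port_par m := hS.port_par (e m)
  port_notMem m := hS.port_notMem (e m)
  injective := hS.injective.comp e.injective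

/-! ### Matching the exits -/

/-- An order-reversing matching of two rectangles of the same size: the first coordinates of
matched points are not both small. -/
theorem exists_matching {r s : ℕ} (hr : 0 < r) (hs : 0 < s) (L : ℕ) :
    ∃ k l : ℕ, 0 < k ∧ 0 < l ∧ L ≤ k ∧
      ∃ e : Fin k × Fin r ≃ Fin l × Fin s, ∀ p, L ≤ (p.1 : ℕ) + (e p).1 := by
  -- Both rectangles have `(L + 2) * r * s` points. In lexicographic order, the point of index `j +
  -- r * i` is sent to the one of complementary index, with first coordinate `q`. Then `(i + 1) * r
  -- + (q + 1) * s` is at least this number, while `r` and `s` are at most `r * s`, so `i + q ≥ L`.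
  have hN : (s * (L + 2)) * r = (r * (L + 2)) * s := by ring
  refine ⟨s * (L + 2), r * (L + 2), by positivity, by positivity, by nlinarith,
    finProdFinEquiv.trans ((finCongr hN).trans (Fin.revPerm.trans finProdFinEquiv.symm)), ?_⟩
  rintro ⟨i, j⟩
  simp only [Equiv.trans_apply, finProdFinEquiv_symm_apply, Fin.coe_divNat, Fin.revPerm_apply,
    Fin.val_rev, finCongr_apply, Fin.val_cast, finProdFinEquiv_apply_val]
  set t := (r * (L + 2) * s - (j + r * i + 1)) with ht
  have h1 := Nat.div_add_mod t s
  have h2 := Nat.mod_lt t hs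
  have h3 := j.2
  by_contra hlt
  push Not at hlt
  set q := t / s
  have h4 : (r * (L + 2) * s) ≤ (i + 1) * r + (q + 1) * s := by
    have : r * (L + 2) * s ≤ t + (j + r * i + 1) := by omega
    nlinarith
  have hrs : (i + 1) * r + (q + 1) * s ≤ ((i : ℕ) + q + 2) * (r * s) := by
    have : r ≤ r * s := Nat.le_mul_of_pos_right r hs
    have : s ≤ r * s := Nat.le_mul_of_pos_left s hr
    nlinarith
  have h5 : ((i : ℕ) + q + 2) * (r * s) < (L + 2) * (r * s) :=
    Nat.mul_lt_mul_of_pos_right (by omega) (by positivity)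
  have h6 : r * (L + 2) * s = (L + 2) * (r * s) := by ring
  omega

/-! ### From correspondences to quasi-isometries -/

theorem dist_map_le_mul_dist {V₁ V₂ : Type*} {T₁ : SimpleGraph V₁} {T₂ : SimpleGraph V₂}
    (h₁ : T₁.Connected) (h₂ : T₂.Connected) {f : V₁ → V₂} {M : ℕ}
    (hf : ∀ x y, T₁.Adj x y → T₂.dist (f x) (f y) ≤ M) (x y : V₁) :
    T₂.dist (f x) (f y) ≤ M * T₁.dist x y := by
  obtain ⟨p, hp⟩ := h₁.exists_walk_length_eq_dist x y
  rw [← hp]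
  clear hp
  induction p with
  | nil => simp
  | @cons u v w huv p ih =>
    rw [SimpleGraph.Walk.length_cons]
    have h1 := h₂.dist_triangle (u := f u) (v := f v) (w := f w)
    have h2 := hf u v huv
    rw [Nat.mul_succ]
    omega

/-- A correspondence between the vertices of two connected graphs that takes neighbours to points
at bounded distance, in both directions, and that coarsely preserves height gives rise to a
coarsely orientation preserving quasi-isometry. -/
theorem coarselyOrientedQI_of_correspondence {V₁ V₂ : Type*} {T₁ : SimpleGraph V₁}
    {T₂ : SimpleGraph V₂} (hT₁ : T₁.Connected) (hT₂ : T₂.Connected) {h₁ : V₁ → ℝ} {h₂ : V₂ → ℝ}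
    (Q : V₁ → V₂ → Prop) (M : ℕ) (C : ℝ) (total₁ : ∀ x, ∃ y, Q x y) (total₂ : ∀ y, ∃ x, Q x y)
    (near₁ : ∀ x y x' y', Q x x' → Q y y' → T₁.Adj x y ∨ x = y → T₂.dist x' y' ≤ M)
    (near₂ : ∀ x y x' y', Q x x' → Q y y' → T₂.Adj x' y' ∨ x' = y' → T₁.dist x y ≤ M)
    (height : ∀ x x', Q x x' → |h₁ x - h₂ x'| ≤ C) : CoarselyOrientedQI T₁ h₁ T₂ h₂ := by
  choose f hf using total₁
  choose g hg using total₂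
  have hfl : ∀ x y, T₂.dist (f x) (f y) ≤ M * T₁.dist x y :=
    dist_map_le_mul_dist hT₁ hT₂ fun x y hxy => near₁ _ _ _ _ (hf x) (hf y) (Or.inl hxy)
  have hgl : ∀ x y, T₁.dist (g x) (g y) ≤ M * T₂.dist x y :=
    dist_map_le_mul_dist hT₂ hT₁ fun x y hxy => near₂ _ _ _ _ (hg x) (hg y) (Or.inl hxy)
  have hgf : ∀ x, T₁.dist x (g (f x)) ≤ M := fun x =>
    near₂ _ _ _ _ (hf x) (hg (f x)) (Or.inr rfl)
  refine ⟨f, ⟨M + 1, 2 * M, by simp, by positivity, fun x y => ⟨?_, ?_⟩, fun y => ⟨g y, ?_⟩⟩,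
    2 * |C| + 1, by positivity, fun v w => ?_⟩
  · have h1 := hT₁.dist_triangle (u := x) (v := g (f x)) (w := y)
    have h2 := hT₁.dist_triangle (u := g (f x)) (v := g (f y)) (w := y)
    have h3 := hgf x
    have h4 := hgf y
    rw [SimpleGraph.dist_comm] at h4
    have h5 := hgl (f x) (f y)
    have h6 : T₁.dist x y ≤ M * T₂.dist (f x) (f y) + 2 * M := by omega
    have h7 : (T₁.dist x y : ℝ) ≤ M * T₂.dist (f x) (f y) + 2 * M := by exact_mod_cast h6
    rw [sub_le_iff_le_add, inv_mul_le_iff₀ (by positivity)]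
    have h8 : (0 : ℝ) ≤ T₂.dist (f x) (f y) := by positivity
    have h9 : (0 : ℝ) ≤ (M : ℝ) * (2 * M) := by positivity
    linarith
  · have h1 : (T₂.dist (f x) (f y) : ℝ) ≤ M * T₁.dist x y := by exact_mod_cast hfl x y
    have h2 : (0 : ℝ) ≤ T₁.dist x y := by positivity
    have h3 : (0 : ℝ) ≤ 2 * M := by positivity
    linarith
  · have h1 : (T₂.dist (f (g y)) y : ℝ) ≤ M := by
      exact_mod_cast near₁ _ _ _ _ (hf (g y)) (hg y) (Or.inr rfl)
    have h2 : (0 : ℝ) ≤ M := by positivity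
    linarith
  · have h1 := abs_le.1 (height v _ (hf v))
    have h2 := abs_le.1 (height w _ (hf w))
    have h3 := le_abs_self C
    rw [abs_le]
    constructor <;> linarith

/-! ### Equivalence of flexible trees -/

/-- A regular tree with bounded height changes in which one can descend and ascend from every
vertex without ever turning back. -/
structure IsFlexibleTree {V : Type*} (T : SimpleGraph V) (h : V → ℝ) (r : ℕ) (B c : ℝ) : Prop where
  isTree : T.IsTree
  ncard_eq : ∀ x, (T.neighborSet x).ncard = r + 2
  height_change_le : ∀ x y, T.Adj x y → |h y - h x| ≤ B
  descents : HasDescents T h c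
  ascents : HasDescents T (fun x => -h x) c

theorem IsFlexibleTree.neg {V : Type*} {T : SimpleGraph V} {h : V → ℝ} {r : ℕ} {B c : ℝ}
    (hT : IsFlexibleTree T h r B c) : IsFlexibleTree T (fun x => -h x) r B c where
  isTree := hT.isTree
  ncard_eq := hT.ncard_eq
  height_change_le x y hxy := by
    rw [neg_sub_neg, abs_sub_comm]
    exact hT.height_change_le x y hxy
  descents := hT.ascents
  ascents := by simpa using hT.descents

theorem IsFlexibleTree.mono {V : Type*} {T : SimpleGraph V} {h : V → ℝ} {r : ℕ} {B B' c c' : ℝ}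
    (hT : IsFlexibleTree T h r B c) (hB : B ≤ B') (hc : c' ≤ c) : IsFlexibleTree T h r B' c' where
  isTree := hT.isTree
  ncard_eq := hT.ncard_eq
  height_change_le x y hxy := (hT.height_change_le x y hxy).trans hB
  descents x := by
    obtain ⟨h1, y, hy, hyx⟩ := hT.descents x
    exact ⟨h1, y, hy, by linarith⟩
  ascents x := by
    obtain ⟨h1, y, hy, hyx⟩ := hT.ascents x
    exact ⟨h1, y, hy, by linarith⟩

/-- Matched clusters in two flexible trees, descending in the first tree and ascending in the
second one, such that height changes in the first tree are dominated by those in the second. -/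
theorem exists_cluster_pair {V₁ V₂ : Type*} {T₁ : SimpleGraph V₁} {T₂ : SimpleGraph V₂}
    {h₁ : V₁ → ℝ} {h₂ : V₂ → ℝ} {r s : ℕ} {B c : ℝ} (hT₁ : IsFlexibleTree T₁ h₁ r B c)
    (hT₂ : IsFlexibleTree T₂ h₂ s B c) (hB : 0 ≤ B) (hc : 0 ≤ c) {a₁ b₁ : V₁} {a₂ b₂ : V₂}
    {par₁ : V₁ → V₁} {par₂ : V₂ → V₂} (hp₁ : IsParentMap T₁ a₁ b₁ par₁)
    (hp₂ : IsParentMap T₂ a₂ b₂ par₂) {k l L : ℕ} (hk : 0 < k) (hl : 0 < l) (hLk : L ≤ k)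
    (hL : 2 * B + 2 * c ≤ c * L) (e : Fin k × Fin r ≃ Fin l × Fin s)
    (he : ∀ p, L ≤ (p.1 : ℕ) + (e p).1) (x₁ : V₁) (x₂ : V₂) :
    ∃ (S₁ : Set V₁) (S₂ : Set V₂) (y₁ : Option (Fin k × Fin r) → V₁)
      (y₂ : Option (Fin k × Fin r) → V₂),
      IsCluster T₁ par₁ S₁ x₁ y₁ ∧ IsCluster T₂ par₂ S₂ x₂ y₂ ∧
      (∀ z ∈ S₁, T₁.dist x₁ z ≤ k) ∧ (∀ z ∈ S₂, T₂.dist x₂ z ≤ l) ∧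
      (∀ m, T₁.dist x₁ (y₁ m) ≤ k + 1) ∧ (∀ m, T₂.dist x₂ (y₂ m) ≤ l + 1) ∧
      ∀ m, h₁ (y₁ m) - h₁ x₁ ≤ h₂ (y₂ m) - h₂ x₂ := by
  obtain ⟨S₁, y₁, hS₁, hd₁, hdy₁, hs₁, hn₁⟩ := exists_descending_cluster hT₁.isTree.connected hp₁
    hT₁.ncard_eq hT₁.height_change_le hc hT₁.descents hk x₁
  obtain ⟨S₂, y₂, hS₂, hd₂, hdy₂, hs₂, hn₂⟩ := exists_descending_cluster hT₂.isTree.connected hp₂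
    hT₂.neg.ncard_eq hT₂.neg.height_change_le hc hT₂.neg.descents hl x₂
  refine ⟨S₁, S₂, y₁, y₂ ∘ e.optionCongr, hS₁, hS₂.reindex e.optionCongr, hd₁, hd₂, hdy₁,
    fun m => hdy₂ _, ?_⟩
  rintro (_ | p)
  · have h1 : c * L ≤ c * k := by gcongr
    have h2 : (0 : ℝ) ≤ c * l := by positivity
    simp only [Function.comp, Equiv.optionCongr_apply, Option.map_none]
    linarith
  -- The first height rises by at most `B + c - c * j`, the second by at least `c * j' - B - c`; as
  -- `j + j' ≥ L`, the choice of `L` absorbs `2 * B + 2 * c`.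
  · have h1 := hs₁ p.1 p.2
    have h2 := hs₂ (e p).1 (e p).2
    have h3 : (L : ℝ) ≤ (p.1 : ℕ) + ((e p).1 : ℕ) := by exact_mod_cast he p
    have h4 := mul_le_mul_of_nonneg_left h3 hc
    simp only [Function.comp, Equiv.optionCongr_apply, Option.map_some]
    linarith

/-- Any two flexible trees are coarsely equivalent. -/
theorem IsFlexibleTree.coarselyOrientedQI {V₁ V₂ : Type*} {T₁ : SimpleGraph V₁}
    {T₂ : SimpleGraph V₂} {h₁ : V₁ → ℝ} {h₂ : V₂ → ℝ} {r s : ℕ} {B c : ℝ}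
    (hT₁ : IsFlexibleTree T₁ h₁ r B c) (hT₂ : IsFlexibleTree T₂ h₂ s B c) (hr : 0 < r)
    (hs : 0 < s) (hc : 0 < c) : CoarselyOrientedQI T₁ h₁ T₂ h₂ := by
  obtain ⟨a₁⟩ := hT₁.isTree.connected.nonempty
  obtain ⟨a₂⟩ := hT₂.isTree.connected.nonempty
  obtain ⟨-, b₁, hab₁, -⟩ := hT₁.descents a₁
  obtain ⟨-, b₂, hab₂, -⟩ := hT₂.descents a₂
  have hB : 0 ≤ B := (abs_nonneg _).trans (hT₁.height_change_le _ _ hab₁)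
  obtain ⟨par₁, hp₁⟩ := exists_isParentMap hT₁.isTree hab₁
  obtain ⟨par₂, hp₂⟩ := exists_isParentMap hT₂.isTree hab₂
  obtain ⟨L, hL⟩ := exists_nat_ge ((2 * B + 2 * c) / c)
  rw [div_le_iff₀' hc] at hL
  obtain ⟨k, l, hk, hl, hLk, e, he⟩ := exists_matching hr hs L
  have hlip₁ := abs_sub_le_mul_dist hT₁.isTree.connected hT₁.height_change_le
  have hlip₂ := abs_sub_le_mul_dist hT₂.isTree.connected hT₂.height_change_le
  obtain ⟨C, hC⟩ : ∃ C : ℝ, C = |h₁ a₁ - h₂ a₂| + |h₁ b₁ - h₂ b₂| + B * (k + 1) + B * (l + 1) :=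
    ⟨_, rfl⟩
  have hk' : 0 ≤ B * (k + 1) := by positivity
  have hl' : 0 ≤ B * (l + 1) := by positivity
  have hCa : |h₁ a₁ - h₂ a₂| ≤ C := by linarith [abs_nonneg (h₁ b₁ - h₂ b₂)]
  have hCb : |h₁ b₁ - h₂ b₂| ≤ C := by linarith [abs_nonneg (h₁ a₁ - h₂ a₂)]
  have hCkl : B * (k + 1) + B * (l + 1) ≤ C := by
    linarith [abs_nonneg (h₁ a₁ - h₂ a₂), abs_nonneg (h₁ b₁ - h₂ b₂)]
  -- The invariant is a discrepancy of at most `C`. The pair of clusters keeps the discrepancy from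
  -- growing on its own side of zero; it can overshoot zero, but by no more than `B * (k + 1) + B *
  -- (l + 1) ≤ C`.
  have step : ∀ q : {q : V₁ × V₂ // |h₁ q.1 - h₂ q.2| ≤ C}, ∃ (S₁ : Set V₁) (S₂ : Set V₂)
      (y : Option (Fin k × Fin r) → {q : V₁ × V₂ // |h₁ q.1 - h₂ q.2| ≤ C}),
      IsCluster T₁ par₁ S₁ q.1.1 (fun m => (y m).1.1) ∧
      IsCluster T₂ par₂ S₂ q.1.2 (fun m => (y m).1.2) ∧
      (∀ z ∈ S₁, T₁.dist q.1.1 z ≤ k) ∧ (∀ z ∈ S₂, T₂.dist q.1.2 z ≤ l) := by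
    rintro ⟨⟨x₁, x₂⟩, hq⟩
    have lip₁ : ∀ y, T₁.dist x₁ y ≤ k + 1 → |h₁ y - h₁ x₁| ≤ B * (k + 1) := fun y hy =>
      (hlip₁ x₁ y).trans (mul_le_mul_of_nonneg_left (by exact_mod_cast hy) hB)
    have lip₂ : ∀ y, T₂.dist x₂ y ≤ l + 1 → |h₂ y - h₂ x₂| ≤ B * (l + 1) := fun y hy =>
      (hlip₂ x₂ y).trans (mul_le_mul_of_nonneg_left (by exact_mod_cast hy) hB)
    simp only [abs_le] at hq lip₁ lip₂
    rcases le_total (h₂ x₂) (h₁ x₁) with hx | hx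
    · obtain ⟨S₁, S₂, y₁, y₂, hS₁, hS₂, hd₁, hd₂, hdy₁, hdy₂, hh⟩ := exists_cluster_pair hT₁ hT₂
        hB hc.le hp₁ hp₂ hk hl hLk hL e he x₁ x₂
      refine ⟨S₁, S₂, fun m => ⟨(y₁ m, y₂ m), ?_⟩, hS₁, hS₂, hd₁, hd₂⟩
      have := lip₁ _ (hdy₁ m)
      have := lip₂ _ (hdy₂ m)
      have := hh m
      rw [abs_le]
      constructor <;> linarith
    · obtain ⟨S₁, S₂, y₁, y₂, hS₁, hS₂, hd₁, hd₂, hdy₁, hdy₂, hh⟩ := exists_cluster_pair hT₁.neg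
        hT₂.neg hB hc.le hp₁ hp₂ hk hl hLk hL e he x₁ x₂
      refine ⟨S₁, S₂, fun m => ⟨(y₁ m, y₂ m), ?_⟩, hS₁, hS₂, hd₁, hd₂⟩
      have := lip₁ _ (hdy₁ m)
      have := lip₂ _ (hdy₂ m)
      have := hh m
      rw [abs_le]
      constructor <;> linarith
  choose S₁ S₂ y hS₁ hS₂ hd₁ hd₂ using step
  -- One recursion produces the cluster starts of both trees, so both systems carry the same
  -- addresses.
  let st : Address (Option (Fin k × Fin r)) → {q : V₁ × V₂ // |h₁ q.1 - h₂ q.2| ≤ C} := fun i =>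
    Address.rec (fun t => if t then ⟨(a₁, a₂), hCa⟩ else ⟨(b₁, b₂), hCb⟩) (fun _ m q => y q m) i
  have sys₁ : IsClusterSystem T₁ a₁ b₁ par₁ (fun i => (st i).1.1) (fun i => S₁ (st i)) :=
    ⟨hp₁, rfl, rfl, fun i => hS₁ (st i)⟩
  have sys₂ : IsClusterSystem T₂ a₂ b₂ par₂ (fun i => (st i).1.2) (fun i => S₂ (st i)) :=
    ⟨hp₂, rfl, rfl, fun i => hS₂ (st i)⟩
  refine coarselyOrientedQI_of_correspondence hT₁.isTree.connected hT₂.isTree.connected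
    (fun x x' => ∃ i, x ∈ S₁ (st i) ∧ x' ∈ S₂ (st i)) (3 * (k + l) + 1) (C + B * k + B * l)
    ?_ ?_ ?_ ?_ ?_
  · intro x
    obtain ⟨i, hi⟩ := sys₁.exists_mem hT₁.isTree.connected x
    exact ⟨_, i, hi, (hS₂ (st i)).mem⟩
  · intro x
    obtain ⟨i, hi⟩ := sys₂.exists_mem hT₂.isTree.connected x
    exact ⟨_, i, (hS₁ (st i)).mem, hi⟩
  · rintro x y x' y' ⟨i, hx, hx'⟩ ⟨j, hy, hy'⟩ hxy
    refine sys₂.dist_le_of_near hT₂.isTree.connected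
      (fun i z hz => (hd₂ (st i) z hz).trans (by omega)) ?_ hx' hy'
    rcases hxy with hxy | rfl
    · exact sys₁.near_of_adj hx hy hxy
    · exact Or.inl (sys₁.address_unique hx hy)
  · rintro x y x' y' ⟨i, hx, hx'⟩ ⟨j, hy, hy'⟩ hxy
    refine sys₁.dist_le_of_near hT₁.isTree.connected
      (fun i z hz => (hd₁ (st i) z hz).trans (by omega)) ?_ hx hy
    rcases hxy with hxy | rfl
    · exact sys₂.near_of_adj hx' hy' hxy
    · exact Or.inl (sys₂.address_unique hx' hy')
  · rintro x x' ⟨i, hx, hx'⟩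
    have h1 := (st i).2
    have h2 := (hlip₁ (st i).1.1 x).trans
      (mul_le_mul_of_nonneg_left (Nat.cast_le.2 (hd₁ _ x hx)) hB)
    have h3 := (hlip₂ (st i).1.2 x').trans
      (mul_le_mul_of_nonneg_left (Nat.cast_le.2 (hd₂ _ x' hx')) hB)
    rw [abs_le] at h1 h2 h3 ⊢
    constructor <;> linarith

/-! ### Trees with one upward edge at every vertex -/

theorem mem_edgeHeightChanges {V : Type*} {T : SimpleGraph V} [T.LocallyFinite] {h : V → ℝ} {v : V}
    {t : ℝ} : t ∈ edgeHeightChanges T h v ↔ ∃ w, T.Adj v w ∧ h w - h v = t := by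
  simp [edgeHeightChanges]

/-- If at every vertex one edge increases height by `a` and every edge leads to the end of such an
edge in one of its two directions, then two vertices joined by a walk below height `H` have a
common ancestor below height `H`. -/
theorem exists_iterate_eq_of_walk {V : Type*} {T : SimpleGraph V} {h : V → ℝ} {up : V → V}
    {a : ℝ} (hup : ∀ v, h (up v) = h v + a) (hadj : ∀ v w, T.Adj v w → up v = w ∨ up w = v) {H : ℝ}
    {v w : V} (p : T.Walk v w) (hp : ∀ z ∈ p.support, h z ≤ H) :
    ∃ i j : ℕ, up^[i] v = up^[j] w ∧ h v + i * a ≤ H := by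
  induction p with
  | nil => exact ⟨0, 0, rfl, by simpa using hp _ (by simp)⟩
  | @cons u v w huv p ih =>
    obtain ⟨i, j, hij, hi⟩ := ih fun z hz => hp z (by simp [hz])
    have hu : h u ≤ H := hp u (by simp)
    rcases hadj u v huv with rfl | rfl
    · refine ⟨i + 1, j, hij, ?_⟩
      rw [hup] at hi
      push_cast
      linarith
    · cases i with
      | zero =>
        refine ⟨0, j + 1, ?_, by simpa using hu⟩
        rw [Function.iterate_succ_apply', ← hij]
        rfl
      | succ i =>
        refine ⟨i, j, hij, ?_⟩
        rw [hup]
        push_cast at hi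
        linarith

theorem dist_iterate_le {V : Type*} {T : SimpleGraph V} (hT : T.Connected) {up : V → V}
    (hadj : ∀ v, T.Adj v (up v)) (v : V) (i : ℕ) : T.dist v (up^[i] v) ≤ i := by
  induction i with
  | zero => simp
  | succ i ih =>
    have h1 := SimpleGraph.dist_eq_one_iff_adj.2 (hadj (up^[i] v))
    have h2 := hT.dist_triangle (u := v) (v := up^[i] v) (w := up^[i + 1] v)
    rw [Function.iterate_succ_apply'] at h2 ⊢
    omega

/-- In a homogeneous tree with exactly one increasing edge at every vertex, any walk between distant
vertices of low height reaches a large height. -/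
theorem OneUpOthersDown.exists_dist_le {V : Type*} {T : SimpleGraph V} [T.LocallyFinite] {h : V → ℝ}
    (hT : T.Connected) (hom : IsHomogeneous T h) (hup : OneUpOthersDown T h) :
    ∃ a : ℝ, 0 < a ∧ (∀ v w, T.Adj v w → |h w - h v| ≤ a) ∧
      ∀ (H : ℝ) (v w : V) (p : T.Walk v w), (∀ z ∈ p.support, h z ≤ H) →
        a * T.dist v w ≤ 2 * H - h v - h w := by
  choose up hadj hlt hdown using hup
  obtain ⟨v₀⟩ := hT.nonempty
  have hor : ∀ v w, T.Adj v w → up v = w ∨ up w = v := by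
    intro v w hvw
    by_contra! hne
    have h1 := hdown v w hvw hne.1.symm
    have h2 := hdown w v hvw.symm hne.2.symm
    linarith
  -- The upward change is the only positive element of the common multiset.
  have hconst : ∀ v w, h (up v) - h v = h (up w) - h w := by
    intro v w
    have h1 : h (up v) - h v ∈ edgeHeightChanges T h w :=
      hom v w ▸ mem_edgeHeightChanges.2 ⟨up v, hadj v, rfl⟩
    obtain ⟨u, hwu, hu⟩ := mem_edgeHeightChanges.1 h1
    by_cases h2 : u = up w
    · rw [← hu, h2]
    · have h3 := hdown w u hwu h2
      have h4 := hlt v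
      linarith
  have hchange : ∀ v, h (up v) = h v + (h (up v₀) - h v₀) := fun v => by
    rw [hconst v₀ v]
    ring
  obtain ⟨a, ha⟩ : ∃ a, a = h (up v₀) - h v₀ := ⟨_, rfl⟩
  rw [← ha] at hchange
  have ha0 : 0 < a := by linarith [hlt v₀]
  refine ⟨a, ha0, ?_, ?_⟩
  · intro v w hvw
    rcases hor v w hvw with rfl | rfl
    · rw [hchange, add_sub_cancel_left, abs_of_pos ha0]
    · rw [abs_sub_comm, hchange, add_sub_cancel_left, abs_of_pos ha0]
  · intro H v w p hp
    -- The common ancestor has height `h v + i * a = h w + j * a ≤ H`, and the distance is at most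
    -- `i + j`.
    obtain ⟨i, j, hij, hi⟩ := exists_iterate_eq_of_walk hchange hor p hp
    have hiter : ∀ (n : ℕ) x, h (up^[n] x) = h x + n * a := by
      intro n x
      induction n with
      | zero => simp
      | succ n ih =>
        rw [Function.iterate_succ_apply', hchange, ih]
        push_cast
        ring
    have h1 := hiter i v
    rw [hij, hiter j w] at h1
    have h2 := hT.dist_triangle (u := v) (v := up^[i] v) (w := w)
    have h3 := dist_iterate_le hT hadj v i
    have h4 := dist_iterate_le hT hadj w j
    rw [← hij, SimpleGraph.dist_comm] at h4
    have h5 : (T.dist v w : ℝ) ≤ i + j := by exact_mod_cast h2.trans (add_le_add h3 h4)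
    have h6 := mul_le_mul_of_nonneg_left h5 ha0.le
    linarith

/-- There are vertices of equal height, arbitrarily far apart, that are joined by a walk below their
height. -/
def HasDeepValleys {V : Type*} (T : SimpleGraph V) (h : V → ℝ) : Prop :=
  ∀ N : ℕ, ∃ (x y : V) (p : T.Walk x y), N ≤ T.dist x y ∧ h y = h x ∧ ∀ z ∈ p.support, h z ≤ h x

theorem exists_walk_support_le {V : Type*} {T : SimpleGraph V} (hT : T.Connected) {h : V → ℝ}
    {a : ℝ} (ha : 0 ≤ a) (hB : ∀ v w, T.Adj v w → |h w - h v| ≤ a) (v w : V) :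
    ∃ p : T.Walk v w, ∀ z ∈ p.support, h z ≤ h v + a * T.dist v w := by
  classical
  obtain ⟨p, hp⟩ := hT.exists_walk_length_eq_dist v w
  refine ⟨p, fun z hz => ?_⟩
  have h1 := (abs_le.1 (abs_sub_le_mul_dist hT hB v z)).2
  have h2 : T.dist v z ≤ T.dist v w := by
    rw [← hp]
    exact (SimpleGraph.dist_le _).trans (p.length_takeUntil_le_length hz)
  have h3 := mul_le_mul_of_nonneg_left (Nat.cast_le (α := ℝ).2 h2) ha
  linarith

/-- A coarse inverse `g` pulls a deep valley back to a walk that stays within a bounded height above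
its ends. These ends are then boundedly close, whereas the valley can be arbitrarily wide. -/
theorem not_coarselyOrientedQI_of_oneUpOthersDown {V₁ V₂ : Type*} {T₁ : SimpleGraph V₁}
    [T₁.LocallyFinite] {T₂ : SimpleGraph V₂} {h₁ : V₁ → ℝ} {h₂ : V₂ → ℝ} (hT₁ : T₁.Connected)
    (hT₂ : T₂.Connected) (hom : IsHomogeneous T₁ h₁) (hup : OneUpOthersDown T₁ h₁)
    (hB₂ : ∀ x y, T₂.Adj x y → |h₂ y - h₂ x| ≤ 1) (hval : HasDeepValleys T₂ h₂) :
    ¬ CoarselyOrientedQI T₁ h₁ T₂ h₂ := by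
  rintro ⟨f, ⟨K, C, hK, hC, hqi, hsurj⟩, D, hD, hheight⟩
  obtain ⟨a, ha, hB, hdist⟩ := hup.exists_dist_le hT₁ hom
  have hK0 : 0 < K := by linarith
  choose g hg using hsurj
  have tri : ∀ x y z, (T₂.dist x z : ℝ) ≤ T₂.dist x y + T₂.dist y z := fun x y z => by
    exact_mod_cast hT₂.dist_triangle
  have hstep : ∀ x y, T₂.Adj x y → (T₁.dist (g x) (g y) : ℝ) ≤ K * (3 * C + 1) := by
    intro x y hxy
    have h1 := (hqi (g x) (g y)).1
    have h2 := tri (f (g x)) x (f (g y))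
    have h3 := tri x y (f (g y))
    have h4 := hg x
    have h5 := hg y
    rw [SimpleGraph.dist_comm] at h5
    have h6 : (T₂.dist x y : ℝ) = 1 := by exact_mod_cast SimpleGraph.dist_eq_one_iff_adj.2 hxy
    have h7 : K⁻¹ * (T₁.dist (g x) (g y) : ℝ) ≤ 3 * C + 1 := by linarith
    rwa [inv_mul_le_iff₀ hK0] at h7
  have hlift : ∀ (H : ℝ) (x y : V₂) (p : T₂.Walk x y), (∀ z ∈ p.support, h₁ (g z) ≤ H) →
      ∃ q : T₁.Walk (g x) (g y), ∀ z ∈ q.support, h₁ z ≤ H + a * (K * (3 * C + 1)) := by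
    intro H x y p hp
    induction p with
    | @nil u =>
      refine ⟨.nil, fun z hz => ?_⟩
      have h1 := hp u (by simp)
      have h2 : 0 ≤ a * (K * (3 * C + 1)) := by positivity
      rw [SimpleGraph.Walk.support_nil, List.mem_singleton] at hz
      rw [hz]
      linarith
    | @cons u v w huv p ih =>
      obtain ⟨q, hq⟩ := ih fun z hz => hp z (by simp [hz])
      obtain ⟨q', hq'⟩ := exists_walk_support_le hT₁ ha.le hB (g u) (g v)
      refine ⟨q'.append q, fun z hz => ?_⟩
      rcases (SimpleGraph.Walk.mem_support_append_iff _ _).1 hz with hz | hz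
      · have h1 := hq' z hz
        have h2 := hp u (by simp)
        have h3 := mul_le_mul_of_nonneg_left (hstep u v huv) ha.le
        linarith
      · exact hq z hz
  have hgh : ∀ x y, |(h₁ (g y) - h₁ (g x)) - (h₂ y - h₂ x)| ≤ D + 2 * C := by
    intro x y
    have hx := abs_sub_le_mul_dist hT₂ hB₂ (f (g x)) x
    rw [one_mul] at hx
    replace hx := hx.trans (hg x)
    have hy := abs_sub_le_mul_dist hT₂ hB₂ (f (g y)) y
    rw [one_mul] at hy
    replace hy := hy.trans (hg y)
    have h1 := hheight (g x) (g y)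
    rw [abs_le] at hx hy h1 ⊢
    constructor <;> linarith
  -- Two errors `D + 2 * C` come from the height bound on the pulled-back walk, a third from
  -- comparing the heights of its ends.
  obtain ⟨E, hE⟩ : ∃ E, E = 3 * (D + 2 * C) + 2 * (a * (K * (3 * C + 1))) := ⟨_, rfl⟩
  obtain ⟨N, hN⟩ := exists_nat_gt (3 * C + K * (E / a))
  obtain ⟨x, y, p, hxy, hyx, hp⟩ := hval N
  obtain ⟨q, hq⟩ := hlift (h₁ (g x) + (D + 2 * C)) x y p fun z hz => by
    have h1 := (abs_le.1 (hgh x z)).2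
    have h2 := hp z hz
    linarith
  have h1 := hdist _ _ _ q hq
  have h2 := (abs_le.1 (hgh x y)).1
  have h3 : (T₁.dist (g x) (g y) : ℝ) ≤ E / a := by
    rw [le_div_iff₀' ha]
    linarith
  have h4 := mul_le_mul_of_nonneg_left h3 hK0.le
  have h5 := (hqi (g x) (g y)).2
  have h6 := tri x (f (g x)) y
  have h7 := tri (f (g x)) (f (g y)) y
  have h8 := hg x
  have h9 := hg y
  rw [SimpleGraph.dist_comm] at h8
  have h10 : (N : ℝ) ≤ T₂.dist x y := by exact_mod_cast hxy
  linarith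

/-! ### Valleys and flexibility of the type (2, 2) tree -/

theorem height22_mul (g k : FreeGroup (Fin 2)) : height22 (g * k) = height22 g + height22 k := by
  simp [height22]

theorem height22_of (i : Fin 2) : height22 (FreeGroup.of i) = 1 := by
  simp [height22]

theorem height22_inv (g : FreeGroup (Fin 2)) : height22 g⁻¹ = -height22 g := by
  simp [height22]

theorem height22_pow (g : FreeGroup (Fin 2)) (n : ℕ) : height22 (g ^ n) = n * height22 g := by
  simp [height22]

theorem tree22_height_change_le (x y : FreeGroup (Fin 2)) (hxy : tree22.Adj x y) :
    |height22 y - height22 x| ≤ 1 := by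
  rcases tree22_isOrientedTreeOfType.height_change x y hxy with h | h <;> simp [h]

theorem tree22_adj_mul_of (g : FreeGroup (Fin 2)) (i : Fin 2) :
    tree22.Adj g (g * FreeGroup.of i) :=
  (tree22_adj _ _).2 ⟨i, Or.inl rfl⟩

theorem tree22_adj_mul_inv_of (g : FreeGroup (Fin 2)) (i : Fin 2) :
    tree22.Adj g (g * (FreeGroup.of i)⁻¹) :=
  (tree22_adj _ _).2 ⟨i, Or.inr (by simp)⟩

theorem exists_walk_mul_pow {u : FreeGroup (Fin 2)} (hu : ∀ g, tree22.Adj g (g * u))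
    (g : FreeGroup (Fin 2)) (n : ℕ) :
    ∃ p : tree22.Walk g (g * u ^ n), ∀ z ∈ p.support, ∃ i ≤ n, z = g * u ^ i := by
  induction n with
  | zero =>
    refine ⟨(SimpleGraph.Walk.nil : tree22.Walk g g).copy rfl (by simp), fun z hz => ⟨0, le_rfl, ?_⟩⟩
    simpa using hz
  | succ n ih =>
    obtain ⟨p, hp⟩ := ih
    refine ⟨(p.concat (hu _)).copy rfl (by rw [pow_succ, mul_assoc]), fun z hz => ?_⟩
    rw [SimpleGraph.Walk.support_copy, SimpleGraph.Walk.support_concat] at hz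
    simp only [List.mem_append, List.mem_singleton] at hz
    rcases hz with hz | rfl
    · obtain ⟨i, hi, rfl⟩ := hp z hz
      exact ⟨i, by omega, rfl⟩
    · exact ⟨n + 1, le_rfl, by rw [pow_succ, mul_assoc]⟩

/-- The exponent sum of the first generator. -/
noncomputable def exponentSum₀ (g : FreeGroup (Fin 2)) : ℝ :=
  Multiplicative.toAdd (FreeGroup.lift (fun i : Fin 2 => Multiplicative.ofAdd
    (if i = 0 then (1 : ℝ) else 0)) g)

/-- A lower bound for distances that needs no computation of reduced words. -/
theorem abs_exponentSum₀_sub_le (x y : FreeGroup (Fin 2)) :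
    |exponentSum₀ y - exponentSum₀ x| ≤ tree22.dist x y := by
  have h := abs_sub_le_mul_dist (h := exponentSum₀) (B := 1) tree22_connected ?_ x y
  · rwa [one_mul] at h
  · intro x y hxy
    rw [tree22_adj] at hxy
    obtain ⟨i, rfl | rfl⟩ := hxy <;> fin_cases i <;> simp [exponentSum₀]

/-- The valley descends along powers of `u` and climbs back along powers of `v`. With different
generators in `u` and `v`, nothing cancels in the exponent sum of the first generator, so the ends
are far apart. -/
theorem hasDeepValleys_of_letters {h : FreeGroup (Fin 2) → ℝ} {u v : FreeGroup (Fin 2)}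
    (hu : ∀ g, tree22.Adj g (g * u)) (hv : ∀ g, tree22.Adj g (g * v))
    (hhu : ∀ g (n : ℕ), h (g * u ^ n) = h g - n) (hhv : ∀ g (n : ℕ), h (g * v ^ n) = h g + n)
    (hsum : ∀ n : ℕ, |exponentSum₀ (u ^ n * v ^ n)| = n) : HasDeepValleys tree22 h := by
  intro N
  obtain ⟨p, hp⟩ := exists_walk_mul_pow hu 1 N
  obtain ⟨q, hq⟩ := exists_walk_mul_pow hv (1 * u ^ N) N
  refine ⟨1, _, p.append q, ?_, ?_, ?_⟩
  · have h1 := abs_exponentSum₀_sub_le 1 (1 * u ^ N * v ^ N)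
    have h2 : exponentSum₀ 1 = 0 := by simp [exponentSum₀]
    rw [h2, sub_zero, one_mul, hsum] at h1
    rw [one_mul]
    exact_mod_cast h1
  · rw [hhv, hhu]
    ring
  · intro z hz
    rcases (SimpleGraph.Walk.mem_support_append_iff _ _).1 hz with hz | hz
    · obtain ⟨i, -, rfl⟩ := hp z hz
      rw [hhu]
      linarith [(Nat.cast_nonneg i : (0 : ℝ) ≤ i)]
    · obtain ⟨i, hi, rfl⟩ := hq z hz
      rw [hhv, hhu]
      linarith [(Nat.cast_le.2 hi : (i : ℝ) ≤ N)]

theorem tree22_hasDeepValleys : HasDeepValleys tree22 height22 :=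
  hasDeepValleys_of_letters (fun g => tree22_adj_mul_inv_of g 0) (fun g => tree22_adj_mul_of g 1)
    (fun g n => by rw [height22_mul, height22_pow, height22_inv, height22_of]; ring)
    (fun g n => by rw [height22_mul, height22_pow, height22_of]; ring)
    (fun n => by simp [exponentSum₀])

theorem tree22_hasDeepValleys_neg : HasDeepValleys tree22 fun x => -height22 x :=
  hasDeepValleys_of_letters (fun g => tree22_adj_mul_of g 0) (fun g => tree22_adj_mul_inv_of g 1)
    (fun g n => by rw [height22_mul, height22_pow, height22_of]; ring)
    (fun g n => by rw [height22_mul, height22_pow, height22_inv, height22_of]; ring)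
    (fun n => by simp [exponentSum₀])

theorem tree22_isFlexibleTree : IsFlexibleTree tree22 height22 2 1 1 where
  isTree := tree22_isOrientedTreeOfType.isTree
  ncard_eq x := by
    have hunion : tree22.neighborSet x = {w | tree22.Adj x w ∧ height22 w - height22 x = 1} ∪
        {w | tree22.Adj x w ∧ height22 w - height22 x = -1} := by
      ext w
      constructor
      · intro hw
        exact (tree22_isOrientedTreeOfType.height_change x w hw).imp (⟨hw, ·⟩) (⟨hw, ·⟩)
      · rintro (hw | hw) <;> exact hw.1
    have hdisj : Disjoint {w | tree22.Adj x w ∧ height22 w - height22 x = 1}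
        {w | tree22.Adj x w ∧ height22 w - height22 x = -1} := by
      rw [Set.disjoint_left]
      rintro w ⟨-, h1⟩ ⟨-, h2⟩
      linarith
    rw [Set.ncard_def, hunion, Set.encard_union_eq hdisj, tree22_isOrientedTreeOfType.card_away,
      tree22_isOrientedTreeOfType.card_towards]
    rfl
  height_change_le := tree22_height_change_le
  descents x := by
    have hh : ∀ i, height22 (x * (FreeGroup.of i)⁻¹) = height22 x - 1 := fun i => by
      rw [height22_mul, height22_inv, height22_of]
      ring
    refine ⟨⟨_, _, ?_, tree22_adj_mul_inv_of x 0, tree22_adj_mul_inv_of x 1, ?_, ?_⟩, _,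
      tree22_adj_mul_inv_of x 0, ?_⟩
    · intro h
      have := FreeGroup.of_injective (inv_injective (mul_left_cancel h))
      simp at this
    all_goals linarith [hh 0, hh 1]
  ascents x := by
    refine ⟨⟨_, _, ?_, tree22_adj_mul_of x 0, tree22_adj_mul_of x 1, ?_, ?_⟩, _,
      tree22_adj_mul_of x 0, ?_⟩
    · intro h
      have := FreeGroup.of_injective (mul_left_cancel h)
      simp at this
    all_goals linarith [height22_mul_of x 0, height22_mul_of x 1]

/-! ### Sign reversal and homogeneous trees -/

theorem oneUpOthersDown_neg {V : Type*} {T : SimpleGraph V} {h : V → ℝ} :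
    OneUpOthersDown T (fun x => -h x) ↔ OneDownOthersUp T h := by
  simp [OneUpOthersDown, OneDownOthersUp]

theorem oneDownOthersUp_neg {V : Type*} {T : SimpleGraph V} {h : V → ℝ} :
    OneDownOthersUp T (fun x => -h x) ↔ OneUpOthersDown T h := by
  simp [OneUpOthersDown, OneDownOthersUp]

theorem CoarselyOrientedQI.neg {V V₂ : Type*} {T : SimpleGraph V} {T₂ : SimpleGraph V₂}
    {h : V → ℝ} {h₂ : V₂ → ℝ} (hqi : CoarselyOrientedQI T h T₂ h₂) :
    CoarselyOrientedQI T (fun x => -h x) T₂ fun x => -h₂ x := by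
  obtain ⟨f, hf, C, hC, hheight⟩ := hqi
  refine ⟨f, hf, C, hC, fun v w => ?_⟩
  have : -h w - -h v - (-h₂ (f w) - -h₂ (f v)) = -(h w - h v - (h₂ (f w) - h₂ (f v))) := by ring
  rw [this, abs_neg]
  exact hheight v w

theorem not_coarselyOrientedQI_tree22_of_const {V : Type*} {T : SimpleGraph V} {h : V → ℝ} {c : ℝ}
    (hc : ∀ v, h v = c) : ¬ CoarselyOrientedQI T h tree22 height22 := by
  rintro ⟨f, ⟨K, C, -, -, -, hsurj⟩, D, -, hheight⟩
  obtain ⟨x₀, -⟩ := hsurj 1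
  obtain ⟨n, hn⟩ := exists_nat_gt (C + D + height22 (f x₀))
  obtain ⟨x, hx⟩ := hsurj (FreeGroup.of 0 ^ n)
  have h1 := abs_sub_le_mul_dist tree22_connected tree22_height_change_le (f x) (FreeGroup.of 0 ^ n)
  have h2 := hheight x₀ x
  rw [height22_pow, height22_of, one_mul, mul_one, abs_le] at h1
  rw [hc, hc, abs_le] at h2
  linarith

variable {V : Type*} {T : SimpleGraph V} [T.LocallyFinite] {h : V → ℝ}

theorem edgeHeightChanges_neg (v : V) :
    edgeHeightChanges T (fun x => -h x) v = (edgeHeightChanges T h v).map Neg.neg := by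
  simp only [edgeHeightChanges, Multiset.map_map]
  refine Multiset.map_congr rfl fun w _ => ?_
  simp only [Function.comp]
  ring

theorem IsHomogeneous.neg (hom : IsHomogeneous T h) : IsHomogeneous T fun x => -h x := fun v w => by
  rw [edgeHeightChanges_neg, edgeHeightChanges_neg, hom v w]

theorem IsHomogeneous.ncard_neighborSet_eq (hom : IsHomogeneous T h) (v w : V) :
    (T.neighborSet v).ncard = (T.neighborSet w).ncard := by
  have hcard : ∀ v, (T.neighborSet v).ncard = (edgeHeightChanges T h v).card := fun v => by
    rw [edgeHeightChanges, Multiset.card_map, ← SimpleGraph.coe_neighborFinset,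
      Set.ncard_coe_finset]
    rfl
  rw [hcard, hcard, hom v w]

theorem IsHomogeneous.exists_adj (hom : IsHomogeneous T h) {v w : V} (hvw : T.Adj v w) (x : V) :
    ∃ y, T.Adj x y ∧ h y - h x = h w - h v :=
  mem_edgeHeightChanges.1 (hom v x ▸ mem_edgeHeightChanges.2 ⟨w, hvw, rfl⟩)

theorem IsHomogeneous.exists_pair (hom : IsHomogeneous T h) (P : ℝ → Prop) {v y z : V}
    (hyz : y ≠ z) (hy : T.Adj v y) (hz : T.Adj v z) (hPy : P (h y - h v)) (hPz : P (h z - h v))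
    (x : V) :
    ∃ y z, y ≠ z ∧ T.Adj x y ∧ T.Adj x z ∧ P (h y - h x) ∧ P (h z - h x) := by
  classical
  have hcard : ∀ v, ((edgeHeightChanges T h v).filter P).card =
      ((T.neighborFinset v).filter fun w => P (h w - h v)).card := fun v => by
    rw [edgeHeightChanges, Multiset.filter_map, Multiset.card_map]
    rfl
  have h1 : 1 < ((T.neighborFinset v).filter fun w => P (h w - h v)).card :=
    Finset.one_lt_card.2 ⟨y, by simp [hy, hPy], z, by simp [hz, hPz], hyz⟩
  rw [← hcard, hom v x, hcard] at h1
  obtain ⟨y, hy, z, hz, hyz⟩ := Finset.one_lt_card.1 h1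
  simp only [Finset.mem_filter, SimpleGraph.mem_neighborFinset] at hy hz
  exact ⟨y, z, hyz, hy.1, hz.1, hy.2, hz.2⟩

/-- Some vertex violates `OneDownOthersUp`. It has a downward edge by homogeneity, hence also
another edge that does not go up; homogeneity carries this pair to every vertex. -/
theorem IsHomogeneous.hasDescents (hom : IsHomogeneous T h) {v w : V} (hvw : T.Adj v w)
    (hlt : h w < h v) (hdown : ¬ OneDownOthersUp T h) : HasDescents T h (h v - h w) := by
  intro x
  constructor
  · simp only [OneDownOthersUp, not_forall, not_exists, not_and] at hdown
    obtain ⟨u, hu⟩ := hdown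
    obtain ⟨y, huy, hy⟩ := hom.exists_adj hvw u
    obtain ⟨z, huz, hzy, hz⟩ := hu y huy (by linarith)
    obtain ⟨y, z, hyz, hxy, hxz, hy, hz⟩ := hom.exists_pair (fun t => t ≤ 0) (Ne.symm hzy) huy huz
      (by linarith) (by linarith) x
    exact ⟨y, z, hyz, hxy, hxz, by linarith, by linarith⟩
  · obtain ⟨y, hxy, hy⟩ := hom.exists_adj hvw x
    exact ⟨y, hxy, by linarith⟩

theorem IsHomogeneous.exists_isFlexibleTree (hom : IsHomogeneous T h) (hT : T.IsTree)
    (hconst : ¬ ∃ c : ℝ, ∀ v, h v = c) (hup : ¬ OneUpOthersDown T h)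
    (hdown : ¬ OneDownOthersUp T h) :
    ∃ (r : ℕ) (B c : ℝ), 0 < r ∧ 0 < c ∧ IsFlexibleTree T h r B c := by
  obtain ⟨v, w, hvw, hlt⟩ : ∃ v w, T.Adj v w ∧ h w < h v := by
    by_contra! hle
    obtain ⟨x⟩ := hT.connected.nonempty
    refine hconst ⟨h x, fun y => ?_⟩
    have := abs_sub_le_mul_dist (h := h) (B := 0) hT.connected (fun v w hvw => by
      rw [le_antisymm (hle v w hvw) (hle w v hvw.symm), sub_self, abs_zero]) x y
    rw [zero_mul] at this
    exact sub_eq_zero.1 (abs_nonpos_iff.1 this)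
  have hdesc := hom.hasDescents hvw hlt hdown
  have hasc : HasDescents T (fun x => -h x) (h v - h w) := by
    have := hom.neg.hasDescents hvw.symm (by linarith) (by rwa [oneDownOthersUp_neg])
    rwa [neg_sub_neg] at this
  obtain ⟨B, hB⟩ : ∃ B : ℝ, ∀ t ∈ edgeHeightChanges T h v, |t| ≤ B := by
    obtain ⟨B, hB⟩ := ((edgeHeightChanges T h v).toFinset.image fun t => |t|).bddAbove
    exact ⟨B, fun t ht => hB (by simpa using ⟨t, ht, rfl⟩)⟩
  -- The lower neighbour `w` differs from the two neighbours that are not lower; hence `r > 0`, so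
  -- that paths have side exits.
  have hdeg : 3 ≤ (T.neighborSet v).ncard := by
    obtain ⟨⟨y, z, hyz, hvy, hvz, hy, hz⟩, -⟩ := hasc v
    have hsub : ({w, y, z} : Set V) ⊆ T.neighborSet v := by
      rintro u (rfl | rfl | rfl) <;> assumption
    have hwy : w ≠ y := by rintro rfl; linarith
    have hwz : w ≠ z := by rintro rfl; linarith
    have := Set.ncard_le_ncard hsub (Set.toFinite _)
    rwa [Set.ncard_eq_three.2 ⟨w, y, z, hwy, hwz, hyz, rfl⟩] at this
  refine ⟨(T.neighborSet v).ncard - 2, B, h v - h w, by omega, by linarith, hT, fun x => ?_,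
    fun x y hxy => ?_, hdesc, hasc⟩
  · rw [hom.ncard_neighborSet_eq x v]
    omega
  · exact hB _ (hom x v ▸ mem_edgeHeightChanges.2 ⟨y, hxy, rfl⟩)

end CoarseTree

/-! ### The classification -/

/-- Exactly one of the three alternatives of the classification holds, and the third one holds
whenever at least two edges increase and at least two edges decrease height at every vertex. -/
theorem mainTheorem3 {V : Type*} (T : SimpleGraph V) [T.LocallyFinite] (h : V → ℝ)
    (hT : T.IsTree) (hom : CoarseTree.IsHomogeneous T h) :
    (((∃ c : ℝ, ∀ v : V, h v = c) ∧
        ¬ (CoarseTree.OneUpOthersDown T h ∨ CoarseTree.OneDownOthersUp T h) ∧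
        ¬ CoarseTree.CoarselyOrientedQI T h CoarseTree.tree22 CoarseTree.height22) ∨
      (¬ (∃ c : ℝ, ∀ v : V, h v = c) ∧
        (CoarseTree.OneUpOthersDown T h ∨ CoarseTree.OneDownOthersUp T h) ∧
        ¬ CoarseTree.CoarselyOrientedQI T h CoarseTree.tree22 CoarseTree.height22) ∨
      (¬ (∃ c : ℝ, ∀ v : V, h v = c) ∧
        ¬ (CoarseTree.OneUpOthersDown T h ∨ CoarseTree.OneDownOthersUp T h) ∧
        CoarseTree.CoarselyOrientedQI T h CoarseTree.tree22 CoarseTree.height22)) ∧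
    ((∀ v : V, 2 ≤ {w : V | T.Adj v w ∧ h v < h w}.encard ∧
        2 ≤ {w : V | T.Adj v w ∧ h w < h v}.encard) →
      CoarseTree.CoarselyOrientedQI T h CoarseTree.tree22 CoarseTree.height22) := by
  have hflex : (¬ ∃ c : ℝ, ∀ v : V, h v = c) →
      ¬ (CoarseTree.OneUpOthersDown T h ∨ CoarseTree.OneDownOthersUp T h) →
      CoarseTree.CoarselyOrientedQI T h CoarseTree.tree22 CoarseTree.height22 := by
    intro hconst hone
    rw [not_or] at hone
    obtain ⟨r, B, c, hr, hc, hflex⟩ := hom.exists_isFlexibleTree hT hconst hone.1 hone.2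
    exact (hflex.mono (le_max_left B 1) (min_le_left c 1)).coarselyOrientedQI
      (CoarseTree.tree22_isFlexibleTree.mono (le_max_right B 1) (min_le_right c 1)) hr two_pos
      (lt_min hc one_pos)
  have hnot : CoarseTree.OneUpOthersDown T h ∨ CoarseTree.OneDownOthersUp T h →
      ¬ CoarseTree.CoarselyOrientedQI T h CoarseTree.tree22 CoarseTree.height22 := by
    rintro (hup | hdown) hqi
    · exact CoarseTree.not_coarselyOrientedQI_of_oneUpOthersDown hT.connected
        CoarseTree.tree22_connected hom hup CoarseTree.tree22_height_change_le
        CoarseTree.tree22_hasDeepValleys hqi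
    · exact CoarseTree.not_coarselyOrientedQI_of_oneUpOthersDown hT.connected
        CoarseTree.tree22_connected hom.neg (CoarseTree.oneUpOthersDown_neg.2 hdown)
        CoarseTree.tree22_isFlexibleTree.neg.height_change_le
        CoarseTree.tree22_hasDeepValleys_neg hqi.neg
  obtain ⟨v₀⟩ := hT.connected.nonempty
  refine ⟨?_, fun htwo => hflex ?_ ?_⟩
  · by_cases hconst : ∃ c : ℝ, ∀ v : V, h v = c
    · obtain ⟨c, hc⟩ := hconst
      refine Or.inl ⟨⟨c, hc⟩, ?_, CoarseTree.not_coarselyOrientedQI_tree22_of_const hc⟩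
      rintro (hup | hdown)
      · obtain ⟨w, -, hw, -⟩ := hup v₀
        rw [hc, hc] at hw
        exact lt_irrefl _ hw
      · obtain ⟨w, -, hw, -⟩ := hdown v₀
        rw [hc, hc] at hw
        exact lt_irrefl _ hw
    · by_cases hone : CoarseTree.OneUpOthersDown T h ∨ CoarseTree.OneDownOthersUp T h
      · exact Or.inr (Or.inl ⟨hconst, hone, hnot hone⟩)
      · exact Or.inr (Or.inr ⟨hconst, hone, hflex hconst hone⟩)
  · rintro ⟨c, hc⟩
    obtain ⟨w, hw⟩ := Set.one_lt_encard_iff_nontrivial.1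
      (lt_of_lt_of_le (by norm_num) (htwo v₀).1) |>.nonempty
    have := hw.2
    rw [hc, hc] at this
    exact lt_irrefl _ this
  · rintro (hup | hdown)
    · obtain ⟨w, -, -, hw⟩ := hup v₀
      obtain ⟨u, hu, huw⟩ := (Set.one_lt_encard_iff_nontrivial.1
        (lt_of_lt_of_le (by norm_num) (htwo v₀).1)).exists_ne w
      exact lt_asymm hu.2 (hw u hu.1 huw)
    · obtain ⟨w, -, -, hw⟩ := hdown v₀
      obtain ⟨u, hu, huw⟩ := (Set.one_lt_encard_iff_nontrivial.1
        (lt_of_lt_of_le (by norm_num) (htwo v₀).2)).exists_ne w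
      exact lt_asymm hu.2 (hw u hu.1 huw)
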